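/- For a commutative ring $R$ and an integer $j\ge 0$, let $K_j^M(R)$ be the quotient of $(R^\times)^{\otimes j}$ by the subgroup generated by the elements $a_1\otimes\cdots\otimes a_j$ such that $a_l+a_m=1$ for some $1\le l<m\le j$ (so $K_0^M(R)=\mathbb Z$). Let $k$ be a commutative ring and let $j,\ell\ge 0$ be integers. Let $\operatorname{Alg}_k^{\mathrm{loc}}$ be the category of local $k$-algebras and local $k$-algebra homomorphisms, and let $$L^{\mathrm{sm}}(K_j^M/\ell):\operatorname{Alg}_k^{\mathrm{loc}}\longrightarrow D^{\le 0}(\mathbb Z)$$ be the (derived) left Kan extension of the functor $R\mapsto K_j^M(R)/\ell K_j^M(R)$ from the full subcategory of local $k$-algebras that are ind-smooth over $k$, i.e. filtered colimits of smooth $k$-algebras; its value at $A$ is the homotopy colimit of the groups $K_j^M(R)/\ell$, placed in degree $0$, over all morphisms $R\to A$ in $\operatorname{Alg}_k^{\mathrm{loc}}$ with $R$ ind-smooth over $k$. Then for every local $k$-algebra $A$ the map $$H_0\big(L^{\mathrm{sm}}(K_j^M/\ell)(A)\big)\longrightarrow K_j^M(A)/\ell$$ induced by the co-unit $L^{\mathrm{sm}}(K_j^M/\ell)\to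 K_j^M/\ell$ is an isomorphism; i.e. Milnor $K$-theory is "right exact". -/

import Mathlib

open CategoryTheory Limits Opposite AlgebraicTopology

open scoped TensorProduct

universe w v₁ v₂ v₃ u₁ u₂ u₃ u

namespace MilnorLKE

/-! ### Milnor K-theory -/

section MilnorK

/-- The subgroup of Steinberg relations in `(Rˣ)^{⊗ j}`: it is generated by the elements
`a₁ ⊗ ⋯ ⊗ a_j` such that `a_l + a_m = 1` for some `l < m`. -/
def steinberg (R : Type u) [CommRing R] (j : ℕ) :
    Submodule ℤ (⨂[ℤ] _ : Fin j, Additive Rˣ) :=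
  Submodule.span ℤ
    {t | ∃ a : Fin j → Rˣ, (∃ l m : Fin j, l < m ∧ (a l : R) + (a m : R) = 1) ∧
      t = PiTensorProduct.tprod ℤ fun i => Additive.ofMul (a i)}

/-- The `j`-th Milnor K-group of a commutative ring, written additively. -/
abbrev MilnorK (R : Type u) [CommRing R] (j : ℕ) : Type u :=
  (⨂[ℤ] _ : Fin j, Additive Rˣ) ⧸ steinberg R j

variable {R : Type u} [CommRing R] {S : Type u} [CommRing S] {T : Type u} [CommRing T]

/-- The group homomorphism `Rˣ → Sˣ` induced by a ring homomorphism, additively. -/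
def unitsMap (f : R →+* S) : Additive Rˣ →ₗ[ℤ] Additive Sˣ :=
  (MonoidHom.toAdditive (Units.map (f : R →* S))).toIntLinearMap

theorem steinberg_le_comap (f : R →+* S) (j : ℕ) :
    steinberg R j ≤ (steinberg S j).comap (PiTensorProduct.map fun _ => unitsMap f) := by
  refine Submodule.span_le.2 ?_
  rintro t ⟨a, ⟨l, m, hlm, h⟩, rfl⟩
  refine Submodule.subset_span ⟨fun i => Units.map (f : R →* S) (a i), ⟨l, m, hlm, ?_⟩, ?_⟩
  · simpa using congrArg f h
  · rw [PiTensorProduct.map_tprod]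
    rfl

/-- `{a₁, …, a_j} ↦ {f a₁, …, f a_j}`. -/
def MilnorK.map (f : R →+* S) (j : ℕ) : MilnorK R j →ₗ[ℤ] MilnorK S j :=
  Submodule.mapQ _ _ (PiTensorProduct.map fun _ => unitsMap f) (steinberg_le_comap f j)

theorem MilnorK.map_id (j : ℕ) : MilnorK.map (RingHom.id R) j = LinearMap.id := by
  apply Submodule.linearMap_qext
  apply PiTensorProduct.ext
  ext a
  simp [MilnorK.map, PiTensorProduct.map_tprod, unitsMap]

theorem MilnorK.map_comp (f : R →+* S) (g : S →+* T) (j : ℕ) :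
    MilnorK.map (g.comp f) j = MilnorK.map g j ∘ₗ MilnorK.map f j := by
  apply Submodule.linearMap_qext
  apply PiTensorProduct.ext
  ext a
  simp [MilnorK.map, PiTensorProduct.map_tprod, unitsMap]
  rfl

/-- The subgroup `ℓ M` of an abelian group `M`. -/
def multiples (M : Type u) [AddCommGroup M] (ℓ : ℕ) : Submodule ℤ M :=
  LinearMap.range ((ℓ : ℤ) • (LinearMap.id : M →ₗ[ℤ] M))

theorem multiples_le_comap {M N : Type u} [AddCommGroup M] [AddCommGroup N] (f : M →ₗ[ℤ] N)
    (ℓ : ℕ) : multiples M ℓ ≤ (multiples N ℓ).comap f := by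
  rintro _ ⟨x, rfl⟩
  exact ⟨f x, by simp⟩

variable (R) in
/-- `K_j^M(R) / ℓ`. -/
abbrev MilnorKMod (j ℓ : ℕ) : Type u :=
  MilnorK R j ⧸ multiples (MilnorK R j) ℓ

/-- Functoriality of `K_j^M(-) / ℓ`. -/
def MilnorKMod.map (f : R →+* S) (j ℓ : ℕ) : MilnorKMod R j ℓ →ₗ[ℤ] MilnorKMod S j ℓ :=
  Submodule.mapQ _ _ (MilnorK.map f j) (multiples_le_comap _ ℓ)

/-- The functor `R ↦ K_j^M(R) / ℓ` from commutative rings to abelian groups. -/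
def milnorKMod (j ℓ : ℕ) : CommRingCat.{u} ⥤ ModuleCat.{u} ℤ where
  obj R := ModuleCat.of ℤ (MilnorKMod R j ℓ)
  map f := ModuleCat.ofHom (MilnorKMod.map f.hom j ℓ)
  map_id R := by
    ext : 1
    apply Submodule.linearMap_qext
    ext x
    simp [MilnorKMod.map, MilnorK.map_id]
  map_comp f g := by
    ext : 1
    apply Submodule.linearMap_qext
    ext x
    simp [MilnorKMod.map, MilnorK.map_comp]

end MilnorK

/-! ### Local algebras and local ind-smooth algebras -/

section LocalAlgebras

/-- Local `k`-algebras. -/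
structure LocAlg (k : Type u) [CommRing k] where
  /-- The underlying type. -/
  carrier : Type u
  [commRing : CommRing carrier]
  [algebra : Algebra k carrier]
  [isLocalRing : IsLocalRing carrier]

attribute [instance] LocAlg.commRing LocAlg.algebra LocAlg.isLocalRing

variable (k : Type u) [CommRing k]

/-- The local `k`-algebra given by an unbundled one. -/
abbrev LocAlg.of (A : Type u) [CommRing A] [Algebra k A] [IsLocalRing A] : LocAlg k :=
  ⟨A⟩

/-- Morphisms of local `k`-algebras are the local `k`-algebra homomorphisms. -/
@[ext]
structure LocAlg.Hom {k : Type u} [CommRing k] (A B : LocAlg k) where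
  /-- The underlying homomorphism of `k`-algebras. -/
  hom : A.carrier →ₐ[k] B.carrier
  isLocalHom : IsLocalHom hom.toRingHom

instance : Category (LocAlg k) where
  Hom A B := LocAlg.Hom A B
  id A := ⟨AlgHom.id k A.carrier, ⟨fun _ h => h⟩⟩
  comp f g := ⟨g.hom.comp f.hom, ⟨fun a h =>
    f.isLocalHom.map_nonunit a (g.isLocalHom.map_nonunit (f.hom a) h)⟩⟩

/-- The forgetful functor from local `k`-algebras to commutative rings. -/
def LocAlg.toCommRing : LocAlg k ⥤ CommRingCat.{u} where
  obj A := CommRingCat.of A.carrier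
  map f := CommRingCat.ofHom (LocAlg.Hom.hom f).toRingHom

/-- A `k`-algebra is ind-smooth if it is a (small) filtered colimit of smooth `k`-algebras. -/
def IsIndSmooth (A : Type u) [CommRing A] [Algebra k A] : Prop :=
  ObjectProperty.ind.{u} (fun B : CommAlgCat.{u} k => Algebra.Smooth k B) (CommAlgCat.of k A)

/-- The local `k`-algebras which are ind-smooth over `k`. -/
def indSmooth : ObjectProperty (LocAlg k) :=
  fun A => IsIndSmooth k A.carrier

/-- The functor `K_j^M / ℓ` on local `k`-algebras. It takes values in abelian groups of the
universe `u + 1`, in which the (large) collection of all local `k`-algebras is small. -/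
def milnorKModLoc (j ℓ : ℕ) : LocAlg k ⥤ ModuleCat.{u + 1} ℤ :=
  LocAlg.toCommRing k ⋙ milnorKMod j ℓ ⋙ ModuleCat.uliftFunctor.{u + 1, u} ℤ

end LocalAlgebras

/-! ### Chain complexes as objects of the derived category -/

section ChainToDerived

variable {𝒜 : Type u₃} [Category.{v₃} 𝒜] [Abelian 𝒜]

theorem extendSingleIso_naturality {X Y : 𝒜} (f : X ⟶ Y) :
    HomologicalComplex.extendMap ((HomologicalComplex.single 𝒜 (ComplexShape.down ℕ) 0).map f)
        ComplexShape.embeddingDownNat ≫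
      (HomologicalComplex.extendSingleIso ComplexShape.embeddingDownNat Y 0 0 (by simp)).hom =
    (HomologicalComplex.extendSingleIso ComplexShape.embeddingDownNat X 0 0 (by simp)).hom ≫
      (HomologicalComplex.single 𝒜 (ComplexShape.up ℤ) 0).map f := by
  refine HomologicalComplex.to_single_hom_ext ?_
  rw [HomologicalComplex.comp_f, HomologicalComplex.comp_f,
    HomologicalComplex.extendMap_f _ _ (show ComplexShape.embeddingDownNat.f 0 = 0 by simp),
    HomologicalComplex.extendSingleIso_hom_f, HomologicalComplex.extendSingleIso_hom_f,
    HomologicalComplex.single_map_f_self, HomologicalComplex.single_map_f_self]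
  simp only [Category.assoc, Iso.inv_hom_id_assoc]

variable [HasDerivedCategory.{w} 𝒜]

variable (𝒜) in
/-- The functor sending a nonnegatively graded chain complex to the corresponding object of the
derived category, placed in cohomological degrees `≤ 0`. -/
noncomputable def chainToDerived : ChainComplex 𝒜 ℕ ⥤ DerivedCategory 𝒜 :=
  ComplexShape.embeddingDownNat.extendFunctor 𝒜 ⋙ DerivedCategory.Q

variable (𝒜) in
/-- An object of `𝒜` in degree zero, as an object of the derived category. -/
noncomputable def singleIso :
    ChainComplex.single₀ 𝒜 ⋙ chainToDerived 𝒜 ≅ DerivedCategory.singleFunctor 𝒜 0 :=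
  NatIso.ofComponents
      (F := ChainComplex.single₀ 𝒜 ⋙ chainToDerived 𝒜)
      (G := CochainComplex.singleFunctor 𝒜 0 ⋙ DerivedCategory.Q)
      (fun X => DerivedCategory.Q.mapIso
        (HomologicalComplex.extendSingleIso ComplexShape.embeddingDownNat X 0 0 (by simp)))
      (fun f => (DerivedCategory.Q.map_comp _ _).symm.trans
        ((congrArg DerivedCategory.Q.map (extendSingleIso_naturality f)).trans
          (DerivedCategory.Q.map_comp _ _))) ≪≫
    (DerivedCategory.singleFunctorIsoCompQ 𝒜 0).symm

end ChainToDerived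

/-! ### Derived left Kan extensions

Let `i : C ⥤ D` be a functor and let `F : C ⥤ 𝒜` be a functor to an abelian category with exact
coproducts. The left Kan extension of `F` along `i`, as a functor with values in the derived
(`∞`-)category of `𝒜`, sends `d` to the homotopy colimit of the objects `F c` over the comma
category of all `i c ⟶ d`. It is computed by the Bousfield-Kan formula (simplicial replacement): it
is represented by the complex associated to the simplicial object
`n ↦ ∐ F c₀`, the coproduct over all `c₀ ⟶ ⋯ ⟶ cₙ` in `C` together with `i cₙ ⟶ d`. -/

section LeftKanExtension

variable {C : Type u₁} [Category.{v₁} C] {D : Type u₂} [Category.{v₂} D] (i : C ⥤ D)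

/-- The `n`-simplices `c₀ ⟶ ⋯ ⟶ cₙ`, `i cₙ ⟶ d` of the nerve of the comma category of `i`
over `d`. -/
structure BarIndex (d : D) (n : SimplexCategoryᵒᵖ) where
  /-- The chain `c₀ ⟶ ⋯ ⟶ cₙ`. -/
  chain : Fin (n.unop.len + 1) ⥤ C
  /-- The structure morphism `i cₙ ⟶ d`. -/
  str : i.obj (chain.obj (Fin.last _)) ⟶ d

variable {i}

/-- The simplicial structure of the nerve of the comma category. -/
abbrev BarIndex.pull {d : D} {n m : SimplexCategoryᵒᵖ} (θ : n ⟶ m) (x : BarIndex i d n) :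
    BarIndex i d m where
  chain := θ.unop.toOrderHom.monotone.functor ⋙ x.chain
  str := i.map (x.chain.map (homOfLE (Fin.le_last _))) ≫ x.str

/-- The functoriality of the nerve of the comma category over `d` in `d`. -/
abbrev BarIndex.push {d e : D} (f : d ⟶ e) {n : SimplexCategoryᵒᵖ} (x : BarIndex i d n) :
    BarIndex i e n where
  chain := x.chain
  str := x.str ≫ f

theorem BarIndex.pull_id {d : D} {n : SimplexCategoryᵒᵖ} (x : BarIndex i d n) :
    x.pull (𝟙 n) = x := by
  obtain ⟨c, s⟩ := x
  have h : i.map (c.map (𝟙 (Fin.last n.unop.len))) ≫ s = s := by simp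
  exact congrArg (BarIndex.mk c) h

theorem BarIndex.pull_comp {d : D} {n m l : SimplexCategoryᵒᵖ} (θ : n ⟶ m) (φ : m ⟶ l)
    (x : BarIndex i d n) : x.pull (θ ≫ φ) = (x.pull θ).pull φ := by
  obtain ⟨c, s⟩ := x
  have h {p q r : Fin (n.unop.len + 1)} (f : p ⟶ q) (g : q ⟶ r) (t : i.obj (c.obj r) ⟶ d) :
      i.map (c.map (f ≫ g)) ≫ t = i.map (c.map f) ≫ i.map (c.map g) ≫ t := by simp
  exact congrArg (BarIndex.mk (i := i) (d := d) (n := l)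
    (φ.unop.toOrderHom.monotone.functor ⋙ θ.unop.toOrderHom.monotone.functor ⋙ c)) (h _ _ s)

variable {𝒜 : Type u₃} [Category.{v₃} 𝒜] [HasCoproducts.{max u₁ v₁ v₂} 𝒜]

/-- The coefficient `F c₀` at the simplex `c₀ ⟶ ⋯ ⟶ cₙ`, `i cₙ ⟶ d`. -/
abbrev BarIndex.coeff (F : C ⥤ 𝒜) {d : D} {n : SimplexCategoryᵒᵖ} (x : BarIndex i d n) : 𝒜 :=
  F.obj (x.chain.obj 0)

/-- The map of coefficients `F c₀ ⟶ F c_{θ 0}`. -/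
abbrev BarIndex.coeffMap (F : C ⥤ 𝒜) {d : D} {n m : SimplexCategoryᵒᵖ} (θ : n ⟶ m)
    (x : BarIndex i d n) : x.coeff F ⟶ (x.pull θ).coeff F :=
  F.map (x.chain.map (homOfLE (Fin.zero_le _)))

variable (i)

/-- The simplicial object `n ↦ ∐ F c₀`, the coproduct over all `c₀ ⟶ ⋯ ⟶ cₙ`, `i cₙ ⟶ d`. -/
noncomputable def barObj (F : C ⥤ 𝒜) (d : D) : SimplicialObject 𝒜 where
  obj n := ∐ fun x : BarIndex i d n => x.coeff F
  map θ := Sigma.desc fun x => x.coeffMap F θ ≫ Sigma.ι (fun y => y.coeff F) (x.pull θ)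
  map_id n := by
    refine Sigma.hom_ext _ _ fun x => ?_
    have h (y : BarIndex i d n) (hy : y = x) (f : x.coeff F ⟶ y.coeff F)
        (hf : f = eqToHom (by rw [hy])) : f ≫ Sigma.ι (fun y => y.coeff F) y =
          Sigma.ι (fun y : BarIndex i d n => y.coeff F) x := by
      subst hy
      simp [hf]
    rw [Sigma.ι_desc, Category.comp_id]
    exact h _ x.pull_id _ ((congrArg F.map (x.chain.map_id 0)).trans (F.map_id _))
  map_comp {n m l} θ φ := by
    refine Sigma.hom_ext _ _ fun x => ?_
    have h (y z : BarIndex i d l) (hy : y = z) (f : x.coeff F ⟶ y.coeff F)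
        (g : x.coeff F ⟶ z.coeff F) (hf : f ≫ eqToHom (by rw [hy]) = g) :
        f ≫ Sigma.ι (fun y => y.coeff F) y =
          g ≫ Sigma.ι (fun y : BarIndex i d l => y.coeff F) z := by
      subst hy
      simp [← hf]
    rw [Sigma.ι_desc, Sigma.ι_desc_assoc, Category.assoc, Sigma.ι_desc, ← Category.assoc]
    refine h _ _ (x.pull_comp θ φ) _ _ ?_
    have h' {p q r : Fin (n.unop.len + 1)} (f : p ⟶ q) (g : q ⟶ r) :
        F.map (x.chain.map (f ≫ g)) = F.map (x.chain.map f) ≫ F.map (x.chain.map g) := by simp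
    exact (Category.comp_id _).trans (h' _ _)

/-- The inclusion of the summand `F c₀` of a simplex. -/
noncomputable def barι (F : C ⥤ 𝒜) {d : D} {n : SimplexCategoryᵒᵖ} (x : BarIndex i d n) :
    x.coeff F ⟶ (barObj i F d).obj n :=
  Sigma.ι (fun y : BarIndex i d n => y.coeff F) x

/-- The morphism out of the `n`-simplices of `barObj` given by its components. -/
noncomputable def barDesc (F : C ⥤ 𝒜) {d : D} {n : SimplexCategoryᵒᵖ} {X : 𝒜}
    (f : ∀ x : BarIndex i d n, x.coeff F ⟶ X) : (barObj i F d).obj n ⟶ X :=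
  Sigma.desc f

theorem barι_desc (F : C ⥤ 𝒜) {d : D} {n : SimplexCategoryᵒᵖ} {X : 𝒜}
    (f : ∀ x : BarIndex i d n, x.coeff F ⟶ X) (x : BarIndex i d n) :
    barι i F x ≫ barDesc i F f = f x :=
  Sigma.ι_desc _ _

theorem barι_map (F : C ⥤ 𝒜) {d : D} {n m : SimplexCategoryᵒᵖ} (θ : n ⟶ m)
    (x : BarIndex i d n) :
    barι i F x ≫ (barObj i F d).map θ = x.coeffMap F θ ≫ barι i F (x.pull θ) :=
  Sigma.ι_desc _ _

theorem barι_desc_comp (F : C ⥤ 𝒜) {d : D} {n : SimplexCategoryᵒᵖ} {X Y : 𝒜}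
    (f : ∀ x : BarIndex i d n, x.coeff F ⟶ X) (x : BarIndex i d n) (g : X ⟶ Y) :
    barι i F x ≫ barDesc i F f ≫ g = f x ≫ g := by
  rw [← Category.assoc, barι_desc]

theorem barι_map_comp (F : C ⥤ 𝒜) {d : D} {n m : SimplexCategoryᵒᵖ} (θ : n ⟶ m)
    (x : BarIndex i d n) {Y : 𝒜} (g : (barObj i F d).obj m ⟶ Y) :
    barι i F x ≫ (barObj i F d).map θ ≫ g = x.coeffMap F θ ≫ barι i F (x.pull θ) ≫ g := by
  rw [← Category.assoc, barι_map, Category.assoc]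

theorem bar_hom_ext (F : C ⥤ 𝒜) {d : D} {n : SimplexCategoryᵒᵖ} {X : 𝒜}
    {f g : (barObj i F d).obj n ⟶ X} (h : ∀ x, barι i F x ≫ f = barι i F x ≫ g) : f = g :=
  Sigma.hom_ext _ _ h

theorem barι_congr (F : C ⥤ 𝒜) {d : D} {n : SimplexCategoryᵒᵖ} (c : Fin (n.unop.len + 1) ⥤ C)
    {s t : i.obj (c.obj (Fin.last _)) ⟶ d} (h : s = t) :
    barι i F (BarIndex.mk c s) = barι i F (BarIndex.mk c t) := by
  rw [h]

/-- The functoriality of `barObj` in `d`. -/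
noncomputable def bar (F : C ⥤ 𝒜) : D ⥤ SimplicialObject 𝒜 where
  obj d := barObj i F d
  map f :=
    { app n := barDesc i F fun x => barι i F (x.push f)
      naturality n m θ := by
        refine bar_hom_ext i F fun x => ?_
        refine (barι_map_comp i F θ x _).trans ?_
        refine (congrArg _ (barι_desc i F _ (x.pull θ))).trans ?_
        refine Eq.trans ?_ (barι_desc_comp i F _ x _).symm
        refine Eq.trans ?_ (barι_map i F θ (x.push f)).symm
        exact congrArg _ (barι_congr i F _ (Category.assoc _ _ _)) }
  map_id d := by
    ext n : 2
    refine bar_hom_ext i F fun x => ?_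
    exact (barι_desc i F _ x).trans
      ((barι_congr i F _ (Category.comp_id _)).trans (Category.comp_id _).symm)
  map_comp f g := by
    ext n : 2
    refine bar_hom_ext i F fun x => ?_
    refine (barι_desc i F _ x).trans ((barι_congr i F _ (Category.assoc _ _ _).symm).trans ?_)
    exact ((barι_desc_comp i F _ x _).trans (barι_desc i F _ (x.push f))).symm

/-- The augmentation of `barObj i (i ⋙ G) d` to `G d`: on the summand of
`c₀ ⟶ ⋯ ⟶ cₙ`, `i cₙ ⟶ d` it is the map `G (i c₀) ⟶ G d` induced by the composite. -/
noncomputable def barAugmented (G : D ⥤ 𝒜) : D ⥤ SimplicialObject.Augmented 𝒜 where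
  obj d :=
    { left := (bar i (i ⋙ G)).obj d
      right := G.obj d
      hom :=
        { app n := barDesc i (i ⋙ G) fun x =>
            G.map (i.map (x.chain.map (homOfLE (Fin.zero_le _))) ≫ x.str)
          naturality n m θ := by
            refine bar_hom_ext i _ fun x => ?_
            have h {p q r l : Fin (n.unop.len + 1)} (f : p ⟶ q) (g : q ⟶ r) (g' : r ⟶ l)
                (f' : p ⟶ l) (t : i.obj (x.chain.obj l) ⟶ d) :
                (i ⋙ G).map (x.chain.map f) ≫
                  G.map (i.map (x.chain.map g) ≫ i.map (x.chain.map g') ≫ t) =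
                G.map (i.map (x.chain.map f') ≫ t) := by
              rw [Subsingleton.elim f' (f ≫ g ≫ g')]
              simp
            refine (barι_map_comp i _ θ x _).trans ?_
            refine (congrArg _ (barι_desc i _ _ (x.pull θ))).trans ?_
            refine Eq.trans ?_ (barι_desc_comp i _ _ x _).symm
            exact (h _ _ _ _ _).trans (Category.comp_id _).symm } }
  map f :=
    { left := (bar i (i ⋙ G)).map f
      right := G.map f
      w := by
        ext n : 2
        refine bar_hom_ext i _ fun x => ?_
        refine (barι_desc_comp i _ _ x _).trans ((barι_desc i _ _ _).trans ?_)
        refine Eq.trans ?_ (barι_desc_comp i _ _ x _).symm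
        exact (congrArg G.map (Category.assoc _ _ _).symm).trans (G.map_comp _ _) }
  map_id d := by
    ext : 1
    · exact (bar i (i ⋙ G)).map_id d
    · exact G.map_id d
  map_comp f g := by
    ext : 1
    · exact (bar i (i ⋙ G)).map_comp f g
    · exact G.map_comp f g

section Derived

variable [Abelian 𝒜] [HasDerivedCategory.{w} 𝒜]

/-- The left Kan extension along `i` of a functor `F : C ⥤ 𝒜`, as a functor to the derived
category. -/
noncomputable def derivedLan (F : C ⥤ 𝒜) : D ⥤ DerivedCategory 𝒜 :=
  bar i F ⋙ alternatingFaceMapComplex 𝒜 ⋙ chainToDerived 𝒜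

/-- The co-unit `i_! i^* G ⟶ G` of the left Kan extension of the restriction along `i` of a
functor `G : D ⥤ 𝒜`. -/
noncomputable def counit (G : D ⥤ 𝒜) :
    derivedLan i (i ⋙ G) ⟶ G ⋙ DerivedCategory.singleFunctor 𝒜 0 :=
  Functor.whiskerLeft (barAugmented i G)
    (Functor.whiskerRight AlternatingFaceMapComplex.ε (chainToDerived 𝒜)) ≫
      Functor.whiskerLeft G (singleIso 𝒜).hom

/-- The map `H₀(i_! i^* G) ⟶ G` induced by the co-unit. -/
noncomputable def counitH₀ (G : D ⥤ 𝒜) :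
    derivedLan i (i ⋙ G) ⋙ DerivedCategory.homologyFunctor 𝒜 0 ⟶ G :=
  Functor.whiskerRight (counit i G) (DerivedCategory.homologyFunctor 𝒜 0) ≫
    Functor.whiskerLeft G (DerivedCategory.singleFunctorCompHomologyFunctorIso 𝒜 0).hom

end Derived

end LeftKanExtension

/-! ### The left Kan extension of Milnor K-theory -/

section Main

variable (k : Type u) [CommRing k] (j ℓ : ℕ) [HasDerivedCategory.{w} (ModuleCat.{u + 1} ℤ)]

/-- `L^sm (K_j^M / ℓ)`: the left Kan extension of `K_j^M / ℓ` from local ind-smooth `k`-algebras to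
all local `k`-algebras. -/
noncomputable def Lsm : LocAlg k ⥤ DerivedCategory (ModuleCat.{u + 1} ℤ) :=
  derivedLan (indSmooth k).ι ((indSmooth k).ι ⋙ milnorKModLoc k j ℓ)

/-- The map `H₀(L^sm (K_j^M / ℓ)(A)) ⟶ K_j^M(A) / ℓ` induced by the co-unit. -/
noncomputable def LsmCounitH₀ (A : LocAlg k) :
    (DerivedCategory.homologyFunctor (ModuleCat.{u + 1} ℤ) 0).obj ((Lsm k j ℓ).obj A) ⟶
      (milnorKModLoc k j ℓ).obj A :=
  (counitH₀ (indSmooth k).ι (milnorKModLoc k j ℓ)).app A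

end Main

end MilnorLKE

/-! `H₀` of the bar construction is the ordinary colimit of `K_j^M(R) / ℓ` over all `R ⟶ A`, so it
is enough that this colimit is `K_j^M(A) / ℓ`. A tuple of units `a` of `A` is a point of affine
space with values in `A`. It lifts to the coordinate functions in the local ring of affine space at
that point, and this lift is universal: it maps to every other lift of `a` along some `R ⟶ A`. Hence
a compatible family of functions of unit tuples on the `R ⟶ A` descends uniquely to `A`. The
relations of Milnor K-theory descend as well, because they can be lifted from `A`: for
multiplicativity one lifts all the entries simultaneously, and if `a_l + a_m = 1` one replaces the
lift of `a_m` by `1 - a_l`, which is a unit since `R ⟶ A` is local. -/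

open scoped Simplicial

namespace MilnorLKE

/-! ### The zeroth homology of the bar construction -/

section Homology

variable {𝒜 : Type u₃} [Category.{v₃} 𝒜] [Abelian 𝒜]

theorem isIso_homologyFunctor_map_chainToDerived_map [HasDerivedCategory.{w} 𝒜]
    {K L : ChainComplex 𝒜 ℕ} (f : K ⟶ L) {n : ℕ} {m : ℤ}
    (hnm : ComplexShape.embeddingDownNat.f n = m) [QuasiIsoAt f n] :
    IsIso ((DerivedCategory.homologyFunctor 𝒜 m).map ((chainToDerived 𝒜).map f)) := by
  have h : QuasiIsoAt (HomologicalComplex.extendMap f ComplexShape.embeddingDownNat) m :=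
    (HomologicalComplex.quasiIsoAt_extendMap_iff f _ hnm).2 inferInstance
  rw [quasiIsoAt_iff_isIso_homologyMap] at h
  exact (NatIso.isIso_map_iff (DerivedCategory.homologyFunctorFactors 𝒜 m) _).2 h

theorem quasiIsoAt_zero_of_isColimit {K : ChainComplex 𝒜 ℕ} {Y : 𝒜}
    (f : K ⟶ (ChainComplex.single₀ 𝒜).obj Y) {π : K.X 0 ⟶ Y} (hf : f.f 0 = π)
    {d : K.X 1 ⟶ K.X 0} (hd : K.d 1 0 = d) (w : d ≫ π = 0)
    (h : IsColimit (CokernelCofork.ofπ π w)) : QuasiIsoAt f 0 := by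
  subst hf hd
  rw [ChainComplex.quasiIsoAt₀_iff, ShortComplex.quasiIso_iff_of_zeros']
  · exact (ShortComplex.exact_and_epi_g_iff_g_is_cokernel _).2 ⟨h⟩
  · exact HomologicalComplex.shape _ _ _ (by simp)
  · exact HomologicalComplex.single_obj_d (ComplexShape.down ℕ) _ _ _ _
  · exact HomologicalComplex.single_obj_d (ComplexShape.down ℕ) _ _ _ _

theorem alternatingFaceMapComplex_d_one_zero (X : SimplicialObject 𝒜) :
    ((alternatingFaceMapComplex 𝒜).obj X).d 1 0 = X.δ 0 - X.δ 1 := by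
  refine (AlternatingFaceMapComplex.obj_d_eq X 0).trans ?_
  simp [Fin.sum_univ_two, sub_eq_add_neg]

theorem quasiIsoAt_ε_app_zero_of_isColimit (X : SimplicialObject.Augmented 𝒜)
    (w : X.left.δ (0 : Fin 2) ≫ X.hom.app (op ⦋0⦌) = X.left.δ 1 ≫ X.hom.app (op ⦋0⦌))
    (h : IsColimit (Cofork.ofπ (X.hom.app (op ⦋0⦌)) w)) :
    QuasiIsoAt (AlternatingFaceMapComplex.ε.app X) 0 :=
  quasiIsoAt_zero_of_isColimit _ (AlternatingFaceMapComplex.ε_app_f_zero X)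
    (alternatingFaceMapComplex_d_one_zero X.left)
    (by rw [Preadditive.sub_comp, w, sub_self])
    (Preadditive.isColimitCokernelCoforkOfCofork h)

end Homology

section Bar

variable {C : Type u₁} [Category.{v₁} C] {D : Type u₂} [Category.{v₂} D] (i : C ⥤ D)
  {𝒜 : Type u₃} [Category.{v₃} 𝒜] [HasCoproducts.{max u₁ v₁ v₂} 𝒜]

namespace BarIndex

variable {i} {d : D}

/-- The vertex of the nerve of the comma category given by an object of the latter. -/
abbrev vertex (X : CostructuredArrow i d) : BarIndex i d (op ⦋0⦌) where
  chain := (Functor.const (Fin 1)).obj X.left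
  str := X.hom

/-- The edge of the nerve of the comma category given by a morphism of the latter. -/
abbrev edge {X Y : CostructuredArrow i d} (f : X ⟶ Y) : BarIndex i d (op ⦋1⦌) where
  chain := ComposableArrows.mk₁ f.left
  str := Y.hom

end BarIndex

theorem exists_eq_const_of_fin_one (x : Fin 1 ⥤ C) : ∃ c, x = (Functor.const (Fin 1)).obj c := by
  refine ⟨x.obj 0, CategoryTheory.Functor.ext (fun p => congrArg x.obj (Subsingleton.elim p 0))
    fun p q f => ?_⟩
  obtain rfl : p = 0 := Subsingleton.elim _ _
  obtain rfl : q = 0 := Subsingleton.elim _ _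
  obtain rfl : f = 𝟙 _ := Subsingleton.elim _ _
  simp

variable (F : C ⥤ 𝒜) {d : D}

/-- The inclusion of the summand `F c` at a vertex `i c ⟶ d`. -/
noncomputable def vertexι (X : CostructuredArrow i d) : F.obj X.left ⟶ (barObj i F d) _⦋0⦌ :=
  barι i F (BarIndex.vertex X)

/-- The inclusion of the summand `F c` at an edge `c ⟶ c'`, `i c' ⟶ d`. -/
noncomputable def edgeι {X Y : CostructuredArrow i d} (f : X ⟶ Y) :
    F.obj X.left ⟶ (barObj i F d) _⦋1⦌ :=
  barι i F (BarIndex.edge f)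

theorem barι_eq_vertexι (x : BarIndex i d (op ⦋0⦌)) :
    barι i F x = vertexι i F (CostructuredArrow.mk x.str) := by
  obtain ⟨c, s⟩ := x
  obtain ⟨c, rfl⟩ := exists_eq_const_of_fin_one c
  rfl

variable {i F} in
theorem bar_zero_hom_ext {Z : 𝒜} {g g' : (barObj i F d) _⦋0⦌ ⟶ Z}
    (h : ∀ X : CostructuredArrow i d, vertexι i F X ≫ g = vertexι i F X ≫ g') : g = g' :=
  bar_hom_ext i F fun x => by
    rw [barι_eq_vertexι]
    exact h _

theorem edgeι_δ_zero {X Y : CostructuredArrow i d} (f : X ⟶ Y) :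
    edgeι i F f ≫ (barObj i F d).δ 0 = F.map f.left ≫ vertexι i F Y := by
  have hY : i.map (𝟙 Y.left) ≫ Y.hom = Y.hom := by simp
  refine (barι_map i F _ _).trans (congrArg (F.map f.left ≫ ·) ?_)
  exact (barι_eq_vertexι i F _).trans (barι_congr i F _ hY)

theorem edgeι_δ_one {X Y : CostructuredArrow i d} (f : X ⟶ Y) :
    edgeι i F f ≫ (barObj i F d).δ 1 = vertexι i F X := by
  refine (barι_map i F _ _).trans (Eq.trans ?_ (Category.id_comp _))
  refine congrArg₂ (· ≫ ·) (F.map_id X.left) ?_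
  exact (barι_eq_vertexι i F _).trans (barι_congr i F _ (CostructuredArrow.w f))

variable {i F} in
/-- The cocone on `F`, over the comma category of `i` over `d`, given by a map out of the
`0`-simplices of the bar construction. -/
noncomputable def barCocone {Z : 𝒜} (g : (barObj i F d) _⦋0⦌ ⟶ Z)
    (hg : (barObj i F d).δ (0 : Fin 2) ≫ g = (barObj i F d).δ 1 ≫ g) :
    Cocone (CostructuredArrow.proj i d ⋙ F) where
  pt := Z
  ι :=
    { app X := vertexι i F X ≫ g
      naturality X Y f := by
        have h : F.map f.left ≫ vertexι i F Y ≫ g = vertexι i F X ≫ g := by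
          rw [← Category.assoc, ← edgeι_δ_zero, ← edgeι_δ_one i F f, Category.assoc,
            Category.assoc, hg]
        exact h.trans (Category.comp_id _).symm }

/-- The augmentation of the bar construction of `G` in simplicial degree `0`, the only part of it
that `H₀` depends on. -/
noncomputable def augmentation (G : D ⥤ 𝒜) (d : D) : (barObj i (i ⋙ G) d) _⦋0⦌ ⟶ G.obj d :=
  ((barAugmented i G).obj d).hom.app (op ⦋0⦌)

variable (G : D ⥤ 𝒜)

theorem vertexι_augmentation (X : CostructuredArrow i d) :
    vertexι i (i ⋙ G) X ≫ augmentation i G d = G.map X.hom := by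
  have hX : i.map (𝟙 X.left) ≫ X.hom = X.hom := by simp
  exact (barι_desc i (i ⋙ G) _ _).trans (congrArg G.map hX)

theorem augmentation_condition :
    (barObj i (i ⋙ G) d).δ (0 : Fin 2) ≫ augmentation i G d =
      (barObj i (i ⋙ G) d).δ 1 ≫ augmentation i G d := by
  have h (p : Fin 2) := ((barAugmented i G).obj d).hom.naturality (SimplexCategory.δ p).op
  exact (h 0).trans (h 1).symm

variable {i G}

theorem nonempty_isColimit_augmentation
    (h : (Functor.LeftExtension.mk G (𝟙 (i ⋙ G))).IsPointwiseLeftKanExtensionAt d) :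
    Nonempty (IsColimit (Cofork.ofπ (augmentation i G d) (augmentation_condition i G))) := by
  have hι {Z : 𝒜} (ψ : G.obj d ⟶ Z) (X : CostructuredArrow i d) :
      vertexι i (i ⋙ G) X ≫ augmentation i G d ≫ ψ =
        ((Functor.LeftExtension.mk G (𝟙 (i ⋙ G))).coconeAt d).ι.app X ≫ ψ := by
    rw [← Category.assoc, vertexι_augmentation]
    exact congrArg (· ≫ ψ) (Category.id_comp (G.map X.hom)).symm
  refine ⟨Cofork.IsColimit.mk _ (fun s => h.desc (barCocone s.π s.condition))
    (fun s => bar_zero_hom_ext fun X => ?_) (fun s m hm => h.hom_ext fun X => ?_)⟩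
  · exact (hι _ X).trans (h.fac (barCocone s.π s.condition) X)
  · refine (hι m X).symm.trans (Eq.trans ?_ (h.fac (barCocone s.π s.condition) X).symm)
    exact congrArg (vertexι i (i ⋙ G) X ≫ ·) hm

variable [Abelian 𝒜] [HasDerivedCategory.{w} 𝒜]

theorem isIso_counitH₀_app
    (h : (Functor.LeftExtension.mk G (𝟙 (i ⋙ G))).IsPointwiseLeftKanExtensionAt d) :
    IsIso ((counitH₀ i G).app d) := by
  let H₀ := DerivedCategory.homologyFunctor 𝒜 0
  let ε := AlternatingFaceMapComplex.ε.app ((barAugmented i G).obj d)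
  obtain ⟨hcolim⟩ := nonempty_isColimit_augmentation h
  have := quasiIsoAt_ε_app_zero_of_isColimit _ _ hcolim
  have hε : IsIso (H₀.map ((chainToDerived 𝒜).map ε)) :=
    isIso_homologyFunctor_map_chainToDerived_map ε (n := 0) (by simp)
  have hsingle : IsIso (H₀.map ((singleIso 𝒜).hom.app (G.obj d))) := inferInstance
  have hcounit : IsIso (H₀.map ((counit i G).app d)) := by
    refine (congrArg IsIso (H₀.map_comp _ _)).mpr ?_
    exact IsIso.comp_isIso' hε hsingle
  exact IsIso.comp_isIso' hcounit (inferInstanceAs (IsIso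
    ((DerivedCategory.singleFunctorCompHomologyFunctorIso 𝒜 0).hom.app (G.obj d))))

end Bar

/-! ### Ind-smoothness of localizations -/

section LocalizationColimit

variable {k B : Type u} [CommRing k] [CommRing B] [Algebra k B]

variable (M : Submonoid B)

/-- The localization of `B` inverting a finite set of elements of `M`. -/
abbrev FiniteLocalization (t : Finset M) : Type u :=
  Localization.Away (∏ x ∈ t, (x : B))

variable {M}

namespace FiniteLocalization

/-- The canonical map from a finite localization to a `B`-algebra in which the elements are
invertible. -/
noncomputable def lift {t : Finset M} {S : Type u} [CommRing S] [Algebra B S]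
    (ht : IsUnit (algebraMap B S (∏ x ∈ t, (x : B)))) : FiniteLocalization M t →ₐ[B] S :=
  IsLocalization.Away.liftAlgHom _ (f := Algebra.ofId B S) ht

instance {t : Finset M} {S : Type u} [CommRing S] [Algebra B S] :
    Subsingleton (FiniteLocalization M t →ₐ[B] S) :=
  IsLocalization.algHom_subsingleton (Submonoid.powers (∏ x ∈ t, (x : B)))

theorem algHom_ext {t : Finset M} {S : Type u} [CommRing S] [Algebra k S]
    {f g : FiniteLocalization M t →ₐ[k] S}
    (h : ∀ b : B, f (algebraMap B _ b) = g (algebraMap B _ b)) : f = g :=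
  IsLocalization.algHom_ext (Submonoid.powers (∏ x ∈ t, (x : B))) (AlgHom.ext h)

theorem isUnit_of_subset {s t : Finset M} (h : s ⊆ t) :
    IsUnit (algebraMap B (FiniteLocalization M t) (∏ x ∈ s, (x : B))) :=
  isUnit_of_dvd_unit (map_dvd _ (Finset.prod_dvd_prod_of_subset s t _ h))
    (IsLocalization.Away.algebraMap_isUnit _)

theorem isUnit_algebraMap_localization_prod (t : Finset M) :
    IsUnit (algebraMap B (Localization M) (∏ x ∈ t, (x : B))) :=
  IsLocalization.map_units (Localization M) ⟨_, M.prod_mem fun x _ => x.2⟩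

/-- The transition map between finite localizations. -/
noncomputable def transition {s t : Finset M} (h : s ⊆ t) :
    FiniteLocalization M s →ₐ[B] FiniteLocalization M t :=
  lift (isUnit_of_subset h)

/-- The map from a finite localization to the localization at `M`. -/
noncomputable def toLocalization (t : Finset M) : FiniteLocalization M t →ₐ[B] Localization M :=
  lift (isUnit_algebraMap_localization_prod t)

end FiniteLocalization

open FiniteLocalization

variable (k M)

/-- The diagram of the localizations of `B` inverting finitely many elements of `M`. -/
noncomputable def finiteLocalizations : Finset M ⥤ CommAlgCat.{u} k where
  obj t := CommAlgCat.of k (FiniteLocalization M t)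
  map f := CommAlgCat.ofHom ((transition f.le).restrictScalars k)
  map_id t := congrArg (fun f : FiniteLocalization M t →ₐ[B] FiniteLocalization M t =>
    CommAlgCat.ofHom (f.restrictScalars k)) (Subsingleton.elim _ (AlgHom.id B _))
  map_comp {s _ r} f g := congrArg (fun f : FiniteLocalization M s →ₐ[B] FiniteLocalization M r =>
    CommAlgCat.ofHom (f.restrictScalars k))
      (Subsingleton.elim _ ((transition g.le).comp (transition f.le)))

/-- The localization at `M` as a cocone over the localizations inverting finitely many elements of
`M`. -/
noncomputable def localizationCocone : Cocone (finiteLocalizations k M) where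
  pt := CommAlgCat.of k (Localization M)
  ι :=
    { app t := CommAlgCat.ofHom ((toLocalization t).restrictScalars k)
      naturality s t f := congrArg (fun f : FiniteLocalization M s →ₐ[B] Localization M =>
        CommAlgCat.ofHom (f.restrictScalars k))
          (Subsingleton.elim ((toLocalization t).comp (transition f.le)) (toLocalization s)) }

variable {k M}

/-- The map `B → C` underlying a cocone `B[1/t] → C` over the finite localizations. -/
noncomputable def coconeBaseHom (s : Cocone (finiteLocalizations k M)) : B →ₐ[k] s.pt :=
  (s.ι.app ∅).hom.comp (IsScalarTower.toAlgHom k B (FiniteLocalization M ∅))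

theorem cocone_algebraMap (s : Cocone (finiteLocalizations k M)) (t : Finset M) (b : B) :
    (s.ι.app t).hom (algebraMap B (FiniteLocalization M t) b) = coconeBaseHom s b := by
  have e := congrArg (fun f => f.hom (algebraMap B (FiniteLocalization M ∅) b))
    (s.w (homOfLE (Finset.empty_subset t)))
  exact (congrArg (s.ι.app t).hom ((transition (Finset.empty_subset t)).commutes b).symm).trans e

theorem isUnit_coconeBaseHom (s : Cocone (finiteLocalizations k M)) (x : M) :
    IsUnit (coconeBaseHom s x) := by
  have hx : IsUnit (algebraMap B (FiniteLocalization M {x}) x) := by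
    simpa using isUnit_of_subset (Finset.Subset.refl {x})
  exact cocone_algebraMap s {x} x ▸ hx.map (s.ι.app {x}).hom

/-- The map `M⁻¹B → C` given by a cocone `B[1/t] → C` over the finite localizations. -/
noncomputable def localizationDesc (s : Cocone (finiteLocalizations k M)) :
    Localization M →ₐ[k] s.pt :=
  IsLocalization.liftAlgHom (isUnit_coconeBaseHom s)

theorem localizationDesc_algebraMap (s : Cocone (finiteLocalizations k M)) (b : B) :
    localizationDesc s (algebraMap B _ b) = coconeBaseHom s b :=
  IsLocalization.lift_eq _ b

variable (k M) in
/-- The localization at `M` is the filtered colimit of the localizations inverting finitely many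
elements of `M`. -/
noncomputable def localizationCoconeIsColimit : IsColimit (localizationCocone k M) where
  desc s := CommAlgCat.ofHom (localizationDesc s)
  fac s t := by
    ext : 1
    refine FiniteLocalization.algHom_ext fun b => ?_
    refine (congrArg (localizationDesc s) ((toLocalization t).commutes b)).trans ?_
    exact (localizationDesc_algebraMap s b).trans (cocone_algebraMap s t b).symm
  uniq s m hm := by
    ext : 1
    let m' : Localization M →ₐ[k] s.pt := m.hom
    change m' = localizationDesc s
    refine IsLocalization.algHom_ext M (AlgHom.ext fun b => ?_)
    refine Eq.trans ?_ (localizationDesc_algebraMap s b).symm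
    refine Eq.trans ?_ (cocone_algebraMap s ∅ b)
    rw [← hm ∅]
    exact congrArg m.hom ((toLocalization ∅).commutes b).symm

theorem isIndSmooth_localization [Algebra.Smooth k B] (M : Submonoid B) :
    IsIndSmooth k (Localization M) := by
  classical
  refine ⟨Finset M, inferInstance, inferInstance,
    ⟨finiteLocalizations k M, _, localizationCoconeIsColimit k M⟩, fun t => ?_⟩
  have := Algebra.Smooth.of_isLocalization_Away (A := FiniteLocalization M t) (∏ x ∈ t, (x : B))
  exact Algebra.Smooth.comp k B (FiniteLocalization M t)

theorem indSmooth_localizationAtPrime_mvPolynomial {σ : Type} [Finite σ]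
    (𝔭 : Ideal (MvPolynomial σ k)) [𝔭.IsPrime] :
    indSmooth k (LocAlg.of k (Localization.AtPrime 𝔭)) :=
  have : Algebra.Smooth k (MvPolynomial σ k) := {}
  isIndSmooth_localization 𝔭.primeCompl

end LocalizationColimit

/-! ### Universal lifts of tuples of units -/

section LocalizationAt

open IsLocalRing

variable {k B : Type u} [CommRing k] [CommRing B] [Algebra k B] {A R : LocAlg k}

/-- The map on units induced by a morphism of local algebras. -/
abbrev LocAlg.Hom.units (f : R ⟶ A) : R.carrierˣ →* A.carrierˣ :=
  Units.map ((LocAlg.Hom.hom f).toRingHom : R.carrier →* A.carrier)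

theorem LocAlg.Hom.comap_maximalIdeal (s : R ⟶ A) :
    (maximalIdeal A.carrier).comap (LocAlg.Hom.hom s) = maximalIdeal R.carrier :=
  have : IsLocalHom (LocAlg.Hom.hom s).toRingHom := s.isLocalHom
  ((local_hom_TFAE (LocAlg.Hom.hom s).toRingHom).out 0 4).1 this

/-- The local ring of `B` at the point given by a homomorphism from `B` to a local algebra. -/
noncomputable abbrev localizationAt (f : B →ₐ[k] A.carrier) : LocAlg k :=
  LocAlg.of k (Localization.AtPrime ((maximalIdeal A.carrier).comap f))

namespace localizationAt

variable {f : B →ₐ[k] A.carrier} (s : R ⟶ A) (g : B →ₐ[k] R.carrier)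
  (hg : s.hom.comp g = f)

include hg

theorem comap_maximalIdeal :
    (maximalIdeal R.carrier).comap g = (maximalIdeal A.carrier).comap f := by
  rw [← hg, ← s.comap_maximalIdeal]
  rfl

theorem isUnit_of_mem_primeCompl (b : ((maximalIdeal A.carrier).comap f).primeCompl) :
    IsUnit (g b) :=
  notMem_maximalIdeal.1 fun hb => b.2 ((comap_maximalIdeal s g hg).le hb)

/-- The homomorphism of algebras underlying `localizationAt.lift`. -/
noncomputable def liftAlgHom : (localizationAt f).carrier →ₐ[k] R.carrier :=
  IsLocalization.liftAlgHom (isUnit_of_mem_primeCompl s g hg)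

theorem liftAlgHom_comp_algebraMap :
    (liftAlgHom s g hg).toRingHom.comp (algebraMap B (localizationAt f).carrier) = g.toRingHom :=
  IsLocalization.lift_comp (isUnit_of_mem_primeCompl s g hg)

/-- The lift to the local ring at a point with values in `A` of a homomorphism to a local algebra
over `A`. -/
noncomputable def lift : localizationAt f ⟶ R where
  hom := liftAlgHom s g hg
  isLocalHom := by
    refine ((local_hom_TFAE _).out 0 2).2 ?_
    rw [← Localization.AtPrime.map_eq_maximalIdeal, Ideal.map_map, liftAlgHom_comp_algebraMap,
      Ideal.map_le_iff_le_comap]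
    exact (comap_maximalIdeal s g hg).ge

theorem lift_algebraMap (b : B) :
    (lift s g hg).hom (algebraMap B (localizationAt f).carrier b) = g b :=
  RingHom.congr_fun (liftAlgHom_comp_algebraMap s g hg) b

omit hg

theorem hom_ext {φ ψ : localizationAt f ⟶ R}
    (h : ∀ b, φ.hom (algebraMap B (localizationAt f).carrier b) =
      ψ.hom (algebraMap B (localizationAt f).carrier b)) : φ = ψ :=
  LocAlg.Hom.ext (IsLocalization.algHom_ext ((maximalIdeal A.carrier).comap f).primeCompl
    (AlgHom.ext h))

end localizationAt

end LocalizationAt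

section UniversalLift

variable {k : Type u} [CommRing k] {P : ObjectProperty (LocAlg k)}
  (hP : ∀ (n : ℕ) (𝔭 : Ideal (MvPolynomial (Fin n) k)) [𝔭.IsPrime],
    P (LocAlg.of k (Localization.AtPrime 𝔭)))
  {A : LocAlg k} {n : ℕ}

include hP

theorem exists_universal_lift (a : Fin n → A.carrierˣ) :
    ∃ (R : P.FullSubcategory) (p : R.obj ⟶ A) (x : Fin n → R.obj.carrierˣ), p.units ∘ x = a ∧
      ∀ (S : P.FullSubcategory) (s : S.obj ⟶ A) (y : Fin n → S.obj.carrierˣ), s.units ∘ y = a →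
        ∃ f : R ⟶ S, f.hom ≫ s = p ∧ f.hom.units ∘ x = y := by
  let f : MvPolynomial (Fin n) k →ₐ[k] A.carrier := MvPolynomial.aeval fun t => (a t : A.carrier)
  let p : localizationAt f ⟶ A := localizationAt.lift (𝟙 A) f rfl
  let coord (t : Fin n) : (localizationAt f).carrier :=
    algebraMap (MvPolynomial (Fin n) k) _ (MvPolynomial.X t)
  have p_coord (t : Fin n) : p.hom (coord t) = a t :=
    (localizationAt.lift_algebraMap (𝟙 A) f rfl _).trans (MvPolynomial.aeval_X _ t)
  have isUnit_coord (t : Fin n) : IsUnit (coord t) :=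
    p.isLocalHom.map_nonunit _ ((p_coord t).symm ▸ (a t).isUnit)
  refine ⟨⟨localizationAt f, hP n _⟩, p, fun t => (isUnit_coord t).unit,
    funext fun t => Units.ext (p_coord t), ?_⟩
  rintro ⟨S, hS⟩ s y hy
  let g : MvPolynomial (Fin n) k →ₐ[k] S.carrier := MvPolynomial.aeval fun t => (y t : S.carrier)
  have s_g : s.hom.comp g = f := MvPolynomial.algHom_ext fun t => by
    simpa [f, g] using congrArg Units.val (congrFun hy t)
  refine ⟨ObjectProperty.homMk (localizationAt.lift s g s_g), localizationAt.hom_ext fun b => ?_,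
    funext fun t => Units.ext ?_⟩
  · refine (congrArg s.hom (localizationAt.lift_algebraMap s g s_g b)).trans ?_
    exact (AlgHom.congr_fun s_g b).trans (localizationAt.lift_algebraMap (𝟙 A) f rfl b).symm
  · exact (localizationAt.lift_algebraMap s g s_g _).trans (MvPolynomial.aeval_X _ t)

theorem exists_lift_unitTuple_pair (a : Fin n → A.carrierˣ) (b c : A.carrierˣ) :
    ∃ (R : P.FullSubcategory) (p : R.obj ⟶ A) (x : Fin n → R.obj.carrierˣ) (y z : R.obj.carrierˣ),
      p.units ∘ x = a ∧ p.units y = b ∧ p.units z = c := by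
  obtain ⟨R, p, x, hx, -⟩ := exists_universal_lift hP (Fin.append a ![b, c])
  refine ⟨R, p, x ∘ Fin.castAdd 2, x (Fin.natAdd n 0), x (Fin.natAdd n 1), ?_, ?_, ?_⟩
  · exact funext fun t => (congrFun hx _).trans (Fin.append_left _ _ t)
  · exact (congrFun hx _).trans (Fin.append_right _ _ _)
  · exact (congrFun hx _).trans (Fin.append_right _ _ _)

theorem exists_unitTuple_desc {M : Type*}
    (φ : ∀ R : P.FullSubcategory, (R.obj ⟶ A) → (Fin n → R.obj.carrierˣ) → M)
    (hφ : ∀ {R S : P.FullSubcategory} (f : R ⟶ S) (s : S.obj ⟶ A) (x : Fin n → R.obj.carrierˣ),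
      φ S s (f.hom.units ∘ x) = φ R (f.hom ≫ s) x) :
    ∃ Φ : (Fin n → A.carrierˣ) → M, ∀ R s x, Φ (s.units ∘ x) = φ R s x := by
  choose R p x _ exists_hom using exists_universal_lift hP (A := A) (n := n)
  refine ⟨fun a => φ (R a) (p a) (x a), fun S s y => ?_⟩
  obtain ⟨f, hp, hy⟩ := exists_hom _ S s y rfl
  change φ (R _) (p _) (x _) = φ S s y
  rw [← hp, ← hφ, hy]

end UniversalLift

/-! ### Symbols -/

section Symbols

variable {R S : Type u} [CommRing R] [CommRing S] {j ℓ : ℕ}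

/-- The class of the symbol `{a₁, …, a_j}` modulo `ℓ`. -/
def symbol (ℓ : ℕ) (a : Fin j → Rˣ) : MilnorKMod R j ℓ :=
  Submodule.Quotient.mk
    (Submodule.Quotient.mk (PiTensorProduct.tprod ℤ fun i => Additive.ofMul (a i)))

theorem map_symbol (f : R →+* S) (a : Fin j → Rˣ) :
    MilnorKMod.map f j ℓ (symbol ℓ a) = symbol ℓ (Units.map (f : R →* S) ∘ a) := by
  change Submodule.Quotient.mk (Submodule.Quotient.mk
    (PiTensorProduct.map (fun _ => unitsMap f) (PiTensorProduct.tprod ℤ _))) = _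
  rw [PiTensorProduct.map_tprod]
  rfl

theorem milnorKMod_hom_ext {M : Type*} [AddCommGroup M] [Module ℤ M]
    {f g : MilnorKMod R j ℓ →ₗ[ℤ] M} (h : ∀ a : Fin j → Rˣ, f (symbol ℓ a) = g (symbol ℓ a)) :
    f = g := by
  apply Submodule.linearMap_qext
  apply Submodule.linearMap_qext
  apply PiTensorProduct.ext
  ext a
  exact h fun i => (a i).toMul

/-- The functions of `j` units of `R` with values in an abelian group that satisfy the relations of
the symbols in `K_j^M(R) / ℓ`. -/
structure IsSteinbergSymbol {M : Type*} [AddCommGroup M] (ℓ : ℕ) (Φ : (Fin j → Rˣ) → M) :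
    Prop where
  map_update_mul (a : Fin j → Rˣ) (i : Fin j) (b c : Rˣ) :
    Φ (Function.update a i (b * c)) = Φ (Function.update a i b) + Φ (Function.update a i c)
  eq_zero_of_add_eq_one (a : Fin j → Rˣ) (l m : Fin j) :
    l < m → (a l : R) + (a m : R) = 1 → Φ a = 0
  smul_eq_zero (a : Fin j → Rˣ) : ℓ • Φ a = 0

theorem isSteinbergSymbol_symbol : IsSteinbergSymbol ℓ (symbol ℓ : (Fin j → Rˣ) → _) where
  map_update_mul a i b c := by
    have h (b : Rˣ) : (fun t => Additive.ofMul (Function.update a i b t)) =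
        Function.update (fun t => Additive.ofMul (a t)) i (Additive.ofMul b) :=
      Function.comp_update _ _ _ _
    simp only [symbol, h, ofMul_mul, MultilinearMap.map_update_add, Submodule.Quotient.mk_add]
  eq_zero_of_add_eq_one a l m hlm h := by
    have : (Submodule.Quotient.mk (PiTensorProduct.tprod ℤ fun i => Additive.ofMul (a i)) :
        MilnorK R j) = 0 :=
      (Submodule.Quotient.mk_eq_zero _).2 (Submodule.subset_span ⟨a, ⟨l, m, hlm, h⟩, rfl⟩)
    rw [symbol, this, Submodule.Quotient.mk_zero]
  smul_eq_zero a := (natCast_zsmul _ ℓ).symm.trans ((Submodule.Quotient.mk_eq_zero _).2 ⟨_, rfl⟩)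

namespace IsSteinbergSymbol

variable {M : Type*} [AddCommGroup M] {Φ : (Fin j → Rˣ) → M}

theorem map {N : Type*} [AddCommGroup N] (hΦ : IsSteinbergSymbol ℓ Φ) (f : M →+ N) :
    IsSteinbergSymbol ℓ (f ∘ Φ) where
  map_update_mul a i b c := by
    simp only [Function.comp_apply, hΦ.map_update_mul, map_add]
  eq_zero_of_add_eq_one a l m hlm h := by
    simp only [Function.comp_apply, hΦ.eq_zero_of_add_eq_one a l m hlm h, map_zero]
  smul_eq_zero a := by
    simp only [Function.comp_apply, ← map_nsmul, hΦ.smul_eq_zero, map_zero]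

variable [Module ℤ M]

/-- A Steinberg symbol as a multilinear map on the additive group of units. -/
def toMultilinearMap (hΦ : IsSteinbergSymbol ℓ Φ) :
    MultilinearMap ℤ (fun _ : Fin j => Additive Rˣ) M :=
  MultilinearMap.mk' (fun a => Φ fun i => (a i).toMul)
    (fun a i b c => hΦ.map_update_mul (fun i => (a i).toMul) i b.toMul c.toMul)
    (fun a i n b => (map_zsmul (AddMonoidHom.mk' (fun b : Additive Rˣ =>
      Φ fun t => (Function.update a i b t).toMul)
        fun b c => hΦ.map_update_mul (fun i => (a i).toMul) i b.toMul c.toMul) n b).trans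
          (int_smul_eq_zsmul _ n _).symm)

/-- A Steinberg symbol as a homomorphism on Milnor K-theory. -/
def liftMilnorK (hΦ : IsSteinbergSymbol ℓ Φ) : MilnorK R j →ₗ[ℤ] M :=
  (steinberg R j).liftQ (PiTensorProduct.lift hΦ.toMultilinearMap) <| Submodule.span_le.2 <| by
    rintro _ ⟨a, ⟨l, m, hlm, h⟩, rfl⟩
    exact (PiTensorProduct.lift.tprod _).trans (hΦ.eq_zero_of_add_eq_one a l m hlm h)

theorem liftMilnorK_mk_tprod (hΦ : IsSteinbergSymbol ℓ Φ) (a : Fin j → Additive Rˣ) :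
    hΦ.liftMilnorK (Submodule.Quotient.mk (PiTensorProduct.tprod ℤ a)) =
      Φ fun i => (a i).toMul :=
  PiTensorProduct.lift.tprod (φ := hΦ.toMultilinearMap) a

theorem smul_liftMilnorK (hΦ : IsSteinbergSymbol ℓ Φ) : ℓ • hΦ.liftMilnorK = 0 := by
  apply Submodule.linearMap_qext
  apply PiTensorProduct.ext
  ext a
  exact (congrArg (ℓ • ·) (hΦ.liftMilnorK_mk_tprod a)).trans (hΦ.smul_eq_zero _)

/-- A Steinberg symbol as a homomorphism on Milnor K-theory modulo `ℓ`. -/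
def lift (hΦ : IsSteinbergSymbol ℓ Φ) : MilnorKMod R j ℓ →ₗ[ℤ] M :=
  (multiples (MilnorK R j) ℓ).liftQ hΦ.liftMilnorK <| by
    rintro _ ⟨x, rfl⟩
    change hΦ.liftMilnorK ((ℓ : ℤ) • x) = 0
    rw [natCast_zsmul, map_nsmul]
    exact LinearMap.congr_fun hΦ.smul_liftMilnorK x

theorem lift_symbol (hΦ : IsSteinbergSymbol ℓ Φ) (a : Fin j → Rˣ) :
    hΦ.lift (symbol ℓ a) = Φ a :=
  hΦ.liftMilnorK_mk_tprod fun i => Additive.ofMul (a i)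

end IsSteinbergSymbol

end Symbols

/-! ### Milnor K-theory as a Kan extension -/

section KanExtension

variable {k : Type u} [CommRing k] {j ℓ : ℕ} {R S : LocAlg k}

/-- The symbol `{a₁, …, a_j}` as an element of the value of `milnorKModLoc` at a local algebra. -/
def locSymbol (ℓ : ℕ) (a : Fin j → R.carrierˣ) : (milnorKModLoc k j ℓ).obj R :=
  ULift.up (symbol ℓ a)

theorem isSteinbergSymbol_locSymbol :
    IsSteinbergSymbol ℓ (locSymbol ℓ : (Fin j → R.carrierˣ) → _) :=
  isSteinbergSymbol_symbol.map AddEquiv.ulift.symm.toAddMonoidHom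

theorem map_locSymbol (f : R ⟶ S) (a : Fin j → R.carrierˣ) :
    (milnorKModLoc k j ℓ).map f (locSymbol ℓ a) = locSymbol ℓ (f.units ∘ a) :=
  congrArg ULift.up (map_symbol _ a)

theorem milnorKModLoc_hom_ext {M : ModuleCat.{u + 1} ℤ} {f g : (milnorKModLoc k j ℓ).obj R ⟶ M}
    (h : ∀ a : Fin j → R.carrierˣ, f (locSymbol ℓ a) = g (locSymbol ℓ a)) : f = g := by
  let up : MilnorKMod R.carrier j ℓ →ₗ[ℤ] (milnorKModLoc k j ℓ).obj R :=
    ULift.moduleEquiv.symm.toLinearMap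
  have e : f.hom ∘ₗ up = g.hom ∘ₗ up := milnorKMod_hom_ext h
  exact ModuleCat.hom_ext (LinearMap.ext fun y => LinearMap.congr_fun e y.down)

theorem IsSteinbergSymbol.exists_hom {M : ModuleCat.{u + 1} ℤ} {Φ : (Fin j → R.carrierˣ) → M}
    (hΦ : IsSteinbergSymbol ℓ Φ) :
    ∃ ψ : (milnorKModLoc k j ℓ).obj R ⟶ M, ∀ a, ψ (locSymbol ℓ a) = Φ a :=
  let down : ULift.{u + 1} (MilnorKMod R.carrier j ℓ) →ₗ[ℤ] MilnorKMod R.carrier j ℓ :=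
    ULift.moduleEquiv.toLinearMap
  ⟨ModuleCat.ofHom (hΦ.lift ∘ₗ down), hΦ.lift_symbol⟩

variable {P : ObjectProperty (LocAlg k)}
  (hP : ∀ (n : ℕ) (𝔭 : Ideal (MvPolynomial (Fin n) k)) [𝔭.IsPrime],
    P (LocAlg.of k (Localization.AtPrime 𝔭)))
  {A : LocAlg k}

include hP

theorem isSteinbergSymbol_of_lifts {M : Type*} [AddCommGroup M] {Φ : (Fin j → A.carrierˣ) → M}
    (h : ∀ (R : P.FullSubcategory) (s : R.obj ⟶ A),
      IsSteinbergSymbol ℓ fun a : Fin j → R.obj.carrierˣ => Φ (s.units ∘ a)) :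
    IsSteinbergSymbol ℓ Φ where
  map_update_mul a i b c := by
    obtain ⟨R, p, a, b, c, rfl, rfl, rfl⟩ := exists_lift_unitTuple_pair hP a b c
    simpa only [Function.comp_update, map_mul] using (h R p).map_update_mul a i b c
  eq_zero_of_add_eq_one a l m hlm hadd := by
    obtain ⟨R, p, a, rfl, -⟩ := exists_universal_lift hP a
    -- `1 - a_l` maps to a unit of `A`, hence is a unit because `R ⟶ A` is local.
    have p_sub : p.hom (1 - (a l : R.obj.carrier)) = (p.units (a m) : A.carrier) := by
      rw [map_sub, map_one, sub_eq_iff_eq_add', ← hadd]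
      rfl
    obtain ⟨u, hu⟩ : IsUnit (1 - (a l : R.obj.carrier)) :=
      p.isLocalHom.map_nonunit _ (p_sub.symm ▸ (p.units (a m)).isUnit)
    have units_u : p.units u = p.units (a m) := Units.ext ((congrArg p.hom hu).trans p_sub)
    have update_zero : Φ (p.units ∘ Function.update a m u) = 0 :=
      (h R p).eq_zero_of_add_eq_one (Function.update a m u) l m hlm (by simp [hlm.ne, hu])
    rw [Function.comp_update, units_u] at update_zero
    exact (congrArg Φ (Function.update_eq_self m _)).symm.trans update_zero
  smul_eq_zero a := by
    obtain ⟨R, p, a, rfl, -⟩ := exists_universal_lift hP a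
    exact (h R p).smul_eq_zero a

theorem exists_milnorKModLoc_desc {M : ModuleCat.{u + 1} ℤ}
    (φ : ∀ R : P.FullSubcategory, (R.obj ⟶ A) → ((milnorKModLoc k j ℓ).obj R.obj ⟶ M))
    (hφ : ∀ {R S : P.FullSubcategory} (f : R ⟶ S) (s : S.obj ⟶ A),
      (milnorKModLoc k j ℓ).map f.hom ≫ φ S s = φ R (f.hom ≫ s)) :
    ∃ ψ : (milnorKModLoc k j ℓ).obj A ⟶ M, ∀ R s, (milnorKModLoc k j ℓ).map s ≫ ψ = φ R s := by
  obtain ⟨Φ, hΦ⟩ := exists_unitTuple_desc hP (fun R s a => φ R s (locSymbol ℓ a))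
    fun f s a => by rw [← hφ, ← map_locSymbol]; rfl
  have steinberg_Φ : IsSteinbergSymbol ℓ Φ := isSteinbergSymbol_of_lifts hP fun R s => by
    simp only [hΦ]
    exact isSteinbergSymbol_locSymbol.map (φ R s).hom.toAddMonoidHom
  obtain ⟨ψ, hψ⟩ := steinberg_Φ.exists_hom
  refine ⟨ψ, fun R s => milnorKModLoc_hom_ext fun a => ?_⟩
  rw [ConcreteCategory.comp_apply, map_locSymbol, hψ, hΦ]

theorem milnorKModLoc_hom_ext_of_lifts {M : ModuleCat.{u + 1} ℤ}
    {ψ ψ' : (milnorKModLoc k j ℓ).obj A ⟶ M}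
    (h : ∀ (R : P.FullSubcategory) (s : R.obj ⟶ A),
      (milnorKModLoc k j ℓ).map s ≫ ψ = (milnorKModLoc k j ℓ).map s ≫ ψ') : ψ = ψ' := by
  refine milnorKModLoc_hom_ext fun a => ?_
  obtain ⟨R, p, a, rfl, -⟩ := exists_universal_lift hP a
  rw [← map_locSymbol]
  exact ConcreteCategory.congr_hom (h R p) (locSymbol ℓ a)

variable (j ℓ A)

theorem nonempty_isPointwiseLeftKanExtensionAt_milnorKModLoc :
    Nonempty ((Functor.LeftExtension.mk (milnorKModLoc k j ℓ)
      (𝟙 (P.ι ⋙ milnorKModLoc k j ℓ))).IsPointwiseLeftKanExtensionAt A) := by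
  refine ⟨IsColimit.ofExistsUnique fun s => ?_⟩
  obtain ⟨ψ, hψ⟩ := exists_milnorKModLoc_desc hP (fun R f => s.ι.app (.mk (Y := R) f))
    fun {R S} f g => s.w (CostructuredArrow.homMk (f := .mk (Y := R) (f.hom ≫ g))
      (f' := .mk (Y := S) g) f)
  refine ⟨ψ, fun X => ?_, fun ψ' hψ' => milnorKModLoc_hom_ext_of_lifts hP fun R f => ?_⟩
  · exact (congrArg (· ≫ ψ) (Category.id_comp _)).trans (hψ X.left X.hom)
  · refine Eq.trans ?_ (hψ R f).symm
    exact (congrArg (· ≫ ψ') (Category.id_comp _).symm).trans (hψ' (.mk (Y := R) f))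

end KanExtension

end MilnorLKE

theorem proposition1p13_general {k : Type u} [CommRing k]
    (P : ObjectProperty (MilnorLKE.LocAlg k))
    (hP : ∀ (n : ℕ) (𝔭 : Ideal (MvPolynomial (Fin n) k)) [𝔭.IsPrime],
      P (MilnorLKE.LocAlg.of k (Localization.AtPrime 𝔭)))
    (j ℓ : ℕ) [HasDerivedCategory.{w} (ModuleCat.{u + 1} ℤ)] (A : MilnorLKE.LocAlg k) :
    IsIso ((MilnorLKE.counitH₀ P.ι (MilnorLKE.milnorKModLoc k j ℓ)).app A) :=
  let ⟨isPointwise⟩ := MilnorLKE.nonempty_isPointwiseLeftKanExtensionAt_milnorKModLoc j ℓ hP A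
  MilnorLKE.isIso_counitH₀_app isPointwise

theorem proposition1p13 (k : Type u) [CommRing k] (j ℓ : ℕ)
    [HasDerivedCategory.{w} (ModuleCat.{u + 1} ℤ)]
    (A : Type u) [CommRing A] [Algebra k A] [IsLocalRing A] :
    IsIso (MilnorLKE.LsmCounitH₀ k j ℓ (MilnorLKE.LocAlg.of k A)) :=
  proposition1p13_general (MilnorLKE.indSmooth k)
    (fun _ => MilnorLKE.indSmooth_localizationAtPrime_mvPolynomial) j ℓ _
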